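/- **Lemma 6.3 (simultaneous $k$th power recurrence).** Let $\mathbb T=\mathbb R/\mathbb Z$ and, for $\beta\in\mathbb T$, let $\|\beta\|$ denote the distance from any real representative of $\beta$ to the nearest integer. For every integer $k\ge 1$ there are real constants $C=C(k)>0$ and $A=A(k)>0$, depending only on $k$, such that for every integer $r\ge 1$, all $\alpha_1,\dots,\alpha_r\in\mathbb T$ and every real $Q\ge 1$, $$\min_{1\le q\le Q}\ \max_{1\le i\le r}\|\alpha_i q^k\|\ \le\ A\,Q^{-\exp(-Cr)},$$ where the minimum is over integers $q$. That is, there is an integer $q$ with $1\le q\le Q$ and $\|\alpha_i q^k\|\le A\,Q^{-\exp(-Cr)}$ for all $1\le i\le r$. -/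

import Mathlib

open Finset

/-! For one frequency, suppose no `n ≤ N = R ^ E` brings `n ^ k • α` within `1 / R` of zero. A
second-moment argument (`exists_large_sum_of_norm_large`) makes the exponential sum of `h • n ^ k •
α` large for some `h ≤ R ^ 2`. Weyl differencing in inverse form
(`exists_nsmul_norm_le_of_large_sum`) then yields a multiple `Q` of `k! * h`, polynomial in `R`,
with `‖Q • α‖` at most a power of `R` over `N ^ k`. As `‖Q ^ k • α‖ ≤ Q ^ (k - 1) * ‖Q • α‖`, a
large `E` gives a contradiction. For several frequencies, induct on `r`: treat the others to finer
accuracy by some `p`, then the last, multiplied by `p ^ k`, by some `s`; the product `s * p` serves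
all. Each frequency multiplies the exponent of `R` by at most a constant `D`, whence `exp (-C r) = D
^ (-r)`. -/

theorem norm_sq_sum_range (z : ℕ → ℂ) (hz : ∀ n, ‖z n‖ = 1) (M : ℕ) :
    ‖∑ n ∈ range M, z n‖ ^ 2 = M + 2 * (∑ h ∈ range M, ∑ n ∈ range (M - (h + 1)),
      z (n + (h + 1)) * (starRingEnd ℂ) (z n)).re := by
  induction M with
  | zero => simp
  | succ M ih =>
    have hstep : ∑ h ∈ range (M + 1), ∑ n ∈ range (M + 1 - (h + 1)),
          z (n + (h + 1)) * (starRingEnd ℂ) (z n) =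
        (∑ h ∈ range M, ∑ n ∈ range (M - (h + 1)), z (n + (h + 1)) * (starRingEnd ℂ) (z n)) +
          z M * (starRingEnd ℂ) (∑ n ∈ range M, z n) := by
      rw [sum_range_succ]
      simp only [Nat.sub_self, range_zero, sum_empty, add_zero]
      rw [map_sum, mul_sum, ← sum_range_reflect (fun n => z M * (starRingEnd ℂ) (z n)),
        ← sum_add_distrib]
      refine sum_congr rfl fun h hh => ?_
      have hlt := mem_range.1 hh
      rw [show M + 1 - (h + 1) = M - (h + 1) + 1 by omega, sum_range_succ,
        show M - 1 - h = M - (h + 1) by omega, show M - (h + 1) + (h + 1) = M by omega]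
    rw [hstep, sum_range_succ, Complex.add_re, mul_add, Complex.sq_norm, Complex.normSq_add,
      ← Complex.sq_norm, ← Complex.sq_norm, ih, hz M]
    have hre : ((∑ n ∈ range M, z n) * (starRingEnd ℂ) (z M)).re =
        (z M * (starRingEnd ℂ) (∑ n ∈ range M, z n)).re := by
      simp only [Complex.mul_re, Complex.conj_re, Complex.conj_im]; ring
    rw [hre]
    push_cast
    ring

/-! ### Norm and characters on the circle -/

theorem exists_real_rep (θ : UnitAddCircle) : ∃ x : ℝ, (x : UnitAddCircle) = θ ∧ |x| = ‖θ‖ := by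
  induction θ using QuotientAddGroup.induction_on with
  | H y =>
    refine ⟨y - round y, ?_, ?_⟩
    · have := AddCircle.coe_sub (1 : ℝ) y (round y)
      rw [this]
      have h0 : (((round y : ℤ) : ℝ) : UnitAddCircle) = 0 :=
        (AddCircle.coe_eq_zero_iff 1).2 ⟨round y, by simp⟩
      rw [h0, sub_zero]
    · exact (UnitAddCircle.norm_eq).symm

theorem norm_circle_le_half (θ : UnitAddCircle) : ‖θ‖ ≤ 1 / 2 := by
  have := AddCircle.norm_le_half_period (1 : ℝ) (x := θ) one_ne_zero
  simpa using this

theorem norm_nsmul_eq {θ : UnitAddCircle} {m : ℕ} (h : m * ‖θ‖ ≤ 1 / 2) :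
    ‖m • θ‖ = m * ‖θ‖ := by
  obtain ⟨x, rfl, hx⟩ := exists_real_rep θ
  rw [← hx] at h ⊢
  have habs : |(m : ℝ) * x| = m * |x| := by rw [abs_mul, Nat.abs_cast]
  rw [← AddCircle.coe_nsmul, nsmul_eq_mul, ← habs]
  refine (AddCircle.norm_coe_eq_abs_iff (1 : ℝ) one_ne_zero).2 ?_
  simpa [habs] using h

/-- The chord has length `2 |sin (π x)|`; Jordan's inequality bounds the sine below. -/
theorem four_mul_norm_le (θ : UnitAddCircle) :
    4 * ‖θ‖ ≤ ‖(AddCircle.toCircle θ : ℂ) - 1‖ := by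
  obtain ⟨x, rfl, hx⟩ := exists_real_rep θ
  have hhalf := norm_circle_le_half (x : UnitAddCircle)
  rw [← hx] at hhalf ⊢
  rw [AddCircle.toCircle_apply_mk, Circle.coe_exp, mul_comm _ Complex.I,
    Complex.norm_exp_I_mul_ofReal_sub_one, Real.norm_eq_abs, abs_mul, abs_two]
  rw [show 2 * Real.pi / 1 * x / 2 = Real.pi * x by ring]
  have h1 : 2 * |x| ≤ |Real.sin (Real.pi * x)| := by
    have h2 := Real.mul_abs_le_abs_sin (x := Real.pi * x) (by
      rw [abs_mul, abs_of_pos Real.pi_pos]; nlinarith [Real.pi_pos])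
    rw [abs_mul, abs_of_pos Real.pi_pos] at h2
    have : 2 / Real.pi * (Real.pi * |x|) = 2 * |x| := by field_simp
    linarith
  linarith

theorem norm_geom_sum_mul_le (θ : UnitAddCircle) (M : ℕ) :
    ‖∑ n ∈ range M, (AddCircle.toCircle (n • θ) : ℂ)‖ * ‖θ‖ ≤ 1 / 2 := by
  have h1 : ∑ n ∈ range M, (AddCircle.toCircle (n • θ) : ℂ) =
      ∑ n ∈ range M, (AddCircle.toCircle θ : ℂ) ^ n := by
    refine sum_congr rfl fun n _ => ?_
    rw [AddCircle.toCircle_nsmul, Circle.coe_pow]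
  have h2 := geom_sum_mul (AddCircle.toCircle θ : ℂ) M
  rw [← h1] at h2
  have h3 : ‖(AddCircle.toCircle θ : ℂ) ^ M - 1‖ ≤ 2 := by
    refine (norm_sub_le _ _).trans ?_
    rw [norm_pow, Circle.norm_coe]
    norm_num
  rw [← h2, norm_mul] at h3
  have h4 := four_mul_norm_le θ
  have h5 := norm_nonneg (∑ n ∈ range M, (AddCircle.toCircle (n • θ) : ℂ))
  nlinarith

/-! ### Many small multiples of one point -/

theorem card_le_of_forall_sub_le {s : Finset ℕ} {D : ℕ}
    (h : ∀ a ∈ s, ∀ b ∈ s, a ≤ b → b - a ≤ D) : s.card ≤ D + 1 := by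
  rcases s.eq_empty_or_nonempty with rfl | hs
  · simp
  · have hsub : s ⊆ Icc (s.min' hs) (s.min' hs + D) := fun b hb => by
      have h1 := s.min'_le b hb
      have h2 := h _ (s.min'_mem hs) b hb h1
      rw [mem_Icc]
      omega
    refine (card_le_card hsub).trans ?_
    simp only [Nat.card_Icc]
    omega

/-- If `‖h • φ‖` is small for a positive proportion of the `h < N`, then a bounded multiple of
`φ` is smaller still by a factor of order `N`. -/
theorem exists_nsmul_norm_le_of_dense {φ : UnitAddCircle} {N L : ℕ} {ε : ℝ} {S : Finset ℕ}
    (hL : 1 ≤ L) (hε : 32 * L * ε ≤ 1) (hSN : ∀ h ∈ S, h < N) (hS : N ≤ L * S.card)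
    (hN : 2 * L < N) (hφ : ∀ h ∈ S, ‖h • φ‖ ≤ ε) :
    ∃ q : ℕ, 1 ≤ q ∧ q ≤ 2 * L ∧ N * ‖q • φ‖ ≤ 16 * L ^ 2 * ε := by
  have hdiff : ∀ a ∈ S, ∀ b ∈ S, a ≤ b → ‖(b - a) • φ‖ ≤ 2 * ε := by
    intro a ha b hb hab
    rw [sub_nsmul φ hab, ← sub_eq_add_neg]
    have := norm_sub_le (b • φ) (a • φ)
    linarith [hφ a ha, hφ b hb]
  -- Pigeonhole: `S` has at least `N / L` elements, more than the number of blocks of length `2 *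
  -- L`.
  have hclose : ∃ q : ℕ, 1 ≤ q ∧ q ≤ 2 * L ∧ ‖q • φ‖ ≤ 2 * ε := by
    have hlt : (range (N / (2 * L) + 1)).card < S.card := by
      rw [card_range]
      have := Nat.div_mul_le_self N (2 * L)
      nlinarith
    obtain ⟨a, ha, b, hb, hne, hab⟩ := exists_ne_map_eq_of_card_lt_of_maps_to hlt
      (f := fun h => h / (2 * L)) (fun h hh => by
        have := Nat.div_le_div_right (c := 2 * L) (hSN h hh).le
        exact mem_coe.2 (mem_range.2 (Nat.lt_succ_of_le this)))
    have hgap : ∀ {x y : ℕ}, x / (2 * L) = y / (2 * L) → y - x ≤ 2 * L := by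
      intro x y hxy
      have h1 := Nat.div_add_mod x (2 * L)
      have h2 := Nat.div_add_mod y (2 * L)
      have h3 := Nat.mod_lt y (show 0 < 2 * L by omega)
      rw [hxy] at h1
      omega
    rcases lt_or_gt_of_ne hne with hlt | hlt
    · exact ⟨b - a, by omega, hgap hab, hdiff a ha b hb hlt.le⟩
    · exact ⟨a - b, by omega, hgap hab.symm, hdiff b hb a ha hlt.le⟩
  obtain ⟨q, hq1, hq2, hqε⟩ := hclose
  refine ⟨q, hq1, hq2, ?_⟩
  set η := ‖q • φ‖ with hη
  have hη0 : 0 ≤ η := norm_nonneg _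
  have hε0 : 0 ≤ ε := by linarith
  rcases hη0.eq_or_lt with h0 | hpos
  · rw [← h0, mul_zero]; positivity
  have hL' : (1 : ℝ) ≤ L := by exact_mod_cast hL
  have hη4 : η ≤ 1 / 4 := by nlinarith
  -- Up to `T` multiples of `q • φ` can be taken without wrapping round the circle.
  set T := ⌊1 / (2 * η)⌋₊ with hT
  have hTη : T * η ≤ 1 / 2 := by
    have := Nat.floor_le (show 0 ≤ 1 / (2 * η) by positivity)
    have h2 := mul_le_mul_of_nonneg_right this hη0
    have h3 : 1 / (2 * η) * η = 1 / 2 := by field_simp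
    linarith
  have hTη' : 1 ≤ 4 * η * T := by
    have := Nat.lt_floor_add_one (1 / (2 * η))
    have h2 := mul_lt_mul_of_pos_right this hpos
    have h3 : 1 / (2 * η) * η = 1 / 2 := by field_simp
    rw [h3, ← hT] at h2
    nlinarith
  have hTpos : 0 < T := by
    rcases Nat.eq_zero_or_pos T with h | h
    · rw [h] at hTη'; norm_num at hTη'
    · exact h
  set D := ⌊2 * ε / η⌋₊ with hD
  have hDle : (D : ℝ) + 1 ≤ 4 * ε / η := by
    have := Nat.floor_le (show 0 ≤ 2 * ε / η by positivity)
    have h1 : 1 ≤ 2 * ε / η := by rw [le_div_iff₀ hpos]; linarith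
    have h2 : 4 * ε / η = 2 * ε / η + 2 * ε / η := by ring
    linarith
  set X := N / q / T with hX
  -- Cells are residue classes mod `q` cut into blocks of `T` terms. Within a cell the norm is
  -- linear, so two members differ by at most `D` multiples of `q`.
  have hcard : S.card ≤ (D + 1) * (range q ×ˢ range (X + 1)).card := by
    refine card_le_mul_card_image_of_maps_to (f := fun h => (h % q, h / q / T)) ?_ _ ?_
    · intro h hh
      refine mem_product.2 ⟨mem_range.2 (Nat.mod_lt _ hq1), mem_range.2 (Nat.lt_succ_of_le ?_)⟩
      exact Nat.div_le_div_right (Nat.div_le_div_right (hSN h hh).le)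
    · rintro ⟨b, t⟩ -
      set F := S.filter fun h => (h % q, h / q / T) = (b, t) with hF
      have hmem : ∀ h ∈ F, h ∈ S ∧ h % q = b ∧ h / q / T = t := fun h hh => by
        have := mem_filter.1 hh
        simpa using this
      have hinj : Set.InjOn (fun h => h / q) (F : Set ℕ) := by
        intro x hx y hy hxy
        have h1 := Nat.div_add_mod x q
        have h2 := Nat.div_add_mod y q
        simp only at hxy
        rw [(hmem x hx).2.1, hxy] at h1
        rw [(hmem y hy).2.1] at h2
        omega
      rw [← card_image_of_injOn hinj]
      refine card_le_of_forall_sub_le ?_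
      intro m hm m' hm' hmm
      obtain ⟨x, hx, rfl⟩ := mem_image.1 hm
      obtain ⟨y, hy, rfl⟩ := mem_image.1 hm'
      obtain ⟨hxS, hxb, hxt⟩ := hmem x hx
      obtain ⟨hyS, hyb, hyt⟩ := hmem y hy
      have h1 := Nat.div_add_mod x q
      have h2 := Nat.div_add_mod y q
      have h3 := Nat.div_add_mod (x / q) T
      have h4 := Nat.div_add_mod (y / q) T
      have h5 := Nat.mod_lt (y / q) hTpos
      rw [hxt] at h3
      rw [hyt] at h4
      have hmT : y / q - x / q ≤ T := by omega
      have hyx : y - x = (y / q - x / q) * q := by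
        rw [Nat.sub_mul, mul_comm (y / q), mul_comm (x / q)]
        omega
      have hxy : x ≤ y := by
        have := Nat.mul_le_mul_left q hmm
        omega
      have h6 := hdiff x hxS y hyS hxy
      have hmη : ((y / q - x / q : ℕ) : ℝ) * η ≤ 1 / 2 := by
        refine le_trans ?_ hTη
        exact mul_le_mul_of_nonneg_right (by exact_mod_cast hmT) hη0
      rw [hyx, mul_nsmul', norm_nsmul_eq hmη] at h6
      refine Nat.le_floor ?_
      rw [le_div_iff₀ hpos]
      exact h6
  rw [card_product, card_range, card_range] at hcard
  have hXN : T * q * X ≤ N := by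
    rw [hX, Nat.div_div_eq_div_mul, mul_comm T q]
    exact Nat.mul_div_le _ _
  have hXN' : (T : ℝ) * q * X ≤ N := by exact_mod_cast hXN
  have hcard' : (S.card : ℝ) ≤ ((D : ℝ) + 1) * (q * (X + 1)) := by exact_mod_cast hcard
  have hS' : (N : ℝ) ≤ L * S.card := by exact_mod_cast hS
  have hq2' : (q : ℝ) ≤ 2 * L := by exact_mod_cast hq2
  have hqX : (q : ℝ) * (X + 1) ≤ 4 * η * N + q := by
    have h1 : (q : ℝ) * X * 1 ≤ q * X * (4 * η * T) :=
      mul_le_mul_of_nonneg_left hTη' (by positivity)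
    have h2 := mul_le_mul_of_nonneg_left hXN' (show 0 ≤ 4 * η by positivity)
    linarith
  have hfin : (N : ℝ) ≤ L * (4 * ε / η * (4 * η * N + 2 * L)) := by
    refine hS'.trans (mul_le_mul_of_nonneg_left (hcard'.trans ?_) (by positivity))
    exact mul_le_mul hDle (by linarith) (by positivity) (by positivity)
  have hfin2 := mul_le_mul_of_nonneg_left hfin hη0
  have hid : η * (L * (4 * ε / η * (4 * η * N + 2 * L))) =
      (16 * L * ε) * (η * N) + 8 * L ^ 2 * ε := by
    field_simp
    ring
  rw [hid] at hfin2
  have hηN : 0 ≤ η * N := by positivity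
  -- The term `16 * L * ε * (η * N)` is at most half of `η * N` and is absorbed.
  nlinarith

/-! ### Weyl differencing -/

theorem exists_card_le_mul_card_fiber {α β : Type*} [DecidableEq β] {s : Finset α} {t : Finset β}
    {f : α → β} (hf : ∀ a ∈ s, f a ∈ t) (ht : t.Nonempty) :
    ∃ b ∈ t, s.card ≤ t.card * (s.filter fun a => f a = b).card := by
  obtain ⟨b, hb, hmax⟩ := exists_max_image t (fun b => (s.filter fun a => f a = b).card) ht
  refine ⟨b, hb, ?_⟩
  rw [mul_comm]
  exact card_le_mul_card_image_of_maps_to hf _ hmax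

/-- Shifts commute with differences, so differencing a phase by `h` lowers its degree by one. -/
theorem fwdDiff_iterate_shift_sub {G : Type*} [AddCommGroup G] (f : ℕ → G) (h k n : ℕ) :
    (fwdDiff 1)^[k] (fun n => f (n + h) - f n) n =
      (fwdDiff 1)^[k] f (n + h) - (fwdDiff 1)^[k] f n := by
  induction k generalizing n with
  | zero => rfl
  | succ k ih =>
    simp only [Function.iterate_succ_apply', fwdDiff] at ih ⊢
    rw [ih, ih, add_right_comm n 1 h]
    abel

theorem shift_sub_eq_nsmul {G : Type*} [AddCommGroup G] {g : ℕ → G} {θ : G}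
    (hg : ∀ n, fwdDiff 1 g n = θ) (n h : ℕ) : g (n + h) - g n = h • θ := by
  induction h with
  | zero => simp
  | succ h ih =>
    rw [succ_nsmul, ← ih, ← hg (n + h), fwdDiff, add_assoc]
    abel

theorem toCircle_mul_conj (x y : UnitAddCircle) :
    (AddCircle.toCircle x : ℂ) * (starRingEnd ℂ) (AddCircle.toCircle y : ℂ) =
      (AddCircle.toCircle (x - y) : ℂ) := by
  rw [← Circle.coe_inv_eq_conj, ← AddCircle.toCircle_neg, ← Circle.coe_mul,
    ← AddCircle.toCircle_add, sub_eq_add_neg]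

/-- Van der Corput's inequality. -/
theorem norm_sq_sum_toCircle_le (f : ℕ → UnitAddCircle) (M : ℕ) :
    ‖∑ n ∈ range M, (AddCircle.toCircle (f n) : ℂ)‖ ^ 2 ≤ M + 2 * ∑ h ∈ range M,
      ‖∑ n ∈ range (M - (h + 1)), (AddCircle.toCircle (f (n + (h + 1)) - f n) : ℂ)‖ := by
  rw [norm_sq_sum_range (fun n => (AddCircle.toCircle (f n) : ℂ)) fun n => Circle.norm_coe _]
  simp only [toCircle_mul_conj]
  have := (Complex.re_le_norm _).trans (norm_sum_le (range M) fun h =>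
    ∑ n ∈ range (M - (h + 1)), (AddCircle.toCircle (f (n + (h + 1)) - f n) : ℂ))
  linarith

theorem norm_sum_toCircle_le (f : ℕ → UnitAddCircle) (M : ℕ) :
    ‖∑ n ∈ range M, (AddCircle.toCircle (f n) : ℂ)‖ ≤ M := by
  refine (norm_sum_le _ _).trans ?_
  refine (sum_le_card_nsmul _ _ 1 fun n _ => (Circle.norm_coe _).le).trans_eq ?_
  rw [card_range, nsmul_one]

/-- Many of the differenced sums of a large exponential sum are large. -/
theorem card_large_differences {R N M : ℕ} (hR : 2 ≤ R) (hMN : M ≤ N) (hN : R ^ 10 < N)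
    (f : ℕ → UnitAddCircle)
    (hf : (N : ℝ) ≤ R * ‖∑ n ∈ range M, (AddCircle.toCircle (f n) : ℂ)‖) :
    N ≤ R ^ 5 * ((range M).filter fun h => (N : ℝ) ≤ R ^ 5 *
      ‖∑ n ∈ range (M - (h + 1)), (AddCircle.toCircle (f (n + (h + 1)) - f n) : ℂ)‖).card := by
  set W : ℕ → ℝ := fun h =>
    ‖∑ n ∈ range (M - (h + 1)), (AddCircle.toCircle (f (n + (h + 1)) - f n) : ℂ)‖ with hW
  set G := (range M).filter fun h => (N : ℝ) ≤ R ^ 5 * W h with hG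
  have hR' : (2 : ℝ) ≤ R := by exact_mod_cast hR
  have hMN' : (M : ℝ) ≤ N := by exact_mod_cast hMN
  have hN' : (R : ℝ) ^ 10 < N := by exact_mod_cast hN
  have hN0 : (0 : ℝ) < N := lt_of_le_of_lt (by positivity) hN'
  have hWN : ∀ h, W h ≤ N := fun h => by
    refine (norm_sum_toCircle_le _ _).trans ?_
    exact_mod_cast (Nat.sub_le _ _).trans hMN
  -- Outside `G` the terms total at most `N ^ 2 / R ^ 5`; after the factor `2 * R ^ 2` this is only
  -- `2 * N ^ 2 / R ^ 3 ≤ N ^ 2 / 4`.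
  have hsum : ∑ h ∈ range M, W h ≤ G.card * N + N * (N / R ^ 5) := by
    rw [← sum_filter_add_sum_filter_not (range M) fun h => (N : ℝ) ≤ R ^ 5 * W h]
    refine add_le_add ?_ ?_
    · simpa using sum_le_card_nsmul _ _ (N : ℝ) fun h _ => hWN h
    · have h1 : ∀ h ∈ (range M).filter fun h => ¬ (N : ℝ) ≤ R ^ 5 * W h, W h ≤ N / R ^ 5 := by
        intro h hh
        have := (mem_filter.1 hh).2
        rw [le_div_iff₀ (by positivity)]
        linarith
      refine (sum_le_card_nsmul _ _ _ h1).trans ?_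
      rw [nsmul_eq_mul]
      refine mul_le_mul_of_nonneg_right ?_ (by positivity)
      refine le_trans ?_ hMN'
      exact_mod_cast (card_filter_le _ _).trans (card_range M).le
  have hvdc := norm_sq_sum_toCircle_le f M
  have hsq : (N : ℝ) ^ 2 ≤ R ^ 2 * (M + 2 * ∑ h ∈ range M, W h) := by
    refine (pow_le_pow_left₀ hN0.le hf 2).trans ?_
    rw [mul_pow]
    exact mul_le_mul_of_nonneg_left hvdc (by positivity)
  have h1 : (N : ℝ) ^ 2 ≤ R ^ 2 * (N + 2 * (G.card * N + N * (N / R ^ 5))) := by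
    refine hsq.trans (mul_le_mul_of_nonneg_left ?_ (by positivity))
    linarith
  have h2 : (N : ℝ) * N ≤ N * (R ^ 2 + 2 * R ^ 2 * G.card + 2 * N / R ^ 3) := by
    refine (sq (N : ℝ) ▸ h1).trans_eq ?_
    field_simp
    ring
  have h3 := le_of_mul_le_mul_left h2 hN0
  have h8 : (8 : ℝ) ≤ R ^ 3 := by
    have := pow_le_pow_left₀ (by norm_num) hR' 3
    norm_num at this
    exact this
  have h4 : 2 * (N : ℝ) / R ^ 3 ≤ N / 4 := by
    rw [div_le_div_iff₀ (by positivity) (by norm_num)]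
    nlinarith
  have h5 : 4 * (R : ℝ) ^ 2 ≤ N := by
    have : (R : ℝ) ^ 4 ≤ R ^ 10 := pow_le_pow_right₀ (by linarith) (by norm_num)
    nlinarith [sq_nonneg ((R : ℝ))]
  have h6 : (N : ℝ) ≤ R ^ 5 * G.card := by
    have : 4 * (R : ℝ) ^ 2 ≤ R ^ 5 := by nlinarith [sq_nonneg (R : ℝ)]
    have := mul_le_mul_of_nonneg_right this (Nat.cast_nonneg (α := ℝ) G.card)
    linarith
  exact_mod_cast h6

/-- Weyl's inequality in inverse form: if `f` has constant `(k + 1)`-st difference `θ` and its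
exponential sum is large, then `θ` is close to a rational with small denominator. -/
theorem exists_nsmul_norm_le_of_large_sum (k : ℕ) : ∃ B : ℕ, ∀ R N M : ℕ, 2 ≤ R → M ≤ N →
    ∀ (f : ℕ → UnitAddCircle) (θ : UnitAddCircle), (∀ n, (fwdDiff 1)^[k + 1] f n = θ) →
      (N : ℝ) ≤ R * ‖∑ n ∈ range M, (AddCircle.toCircle (f n) : ℂ)‖ →
        ∃ q : ℕ, 1 ≤ q ∧ q ≤ R ^ B ∧ (N : ℝ) ^ (k + 1) * ‖q • θ‖ ≤ R ^ B := by
  induction k with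
  | zero =>
    refine ⟨1, fun R N M hR _ f θ hf hS => ⟨1, le_rfl, by rw [pow_one]; omega, ?_⟩⟩
    have hfn : ∀ n, f n = f 0 + n • θ := fun n => by
      rw [← shift_sub_eq_nsmul hf 0 n, zero_add]
      abel
    have hsum : ∑ n ∈ range M, (AddCircle.toCircle (f n) : ℂ) =
        (AddCircle.toCircle (f 0) : ℂ) * ∑ n ∈ range M, (AddCircle.toCircle (n • θ) : ℂ) := by
      rw [mul_sum]
      refine sum_congr rfl fun n _ => ?_
      rw [hfn n, AddCircle.toCircle_add, Circle.coe_mul]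
    rw [hsum, norm_mul, Circle.norm_coe, one_mul] at hS
    have hgeom := norm_geom_sum_mul_le θ M
    have h1 := mul_le_mul_of_nonneg_right hS (norm_nonneg θ)
    have hR0 : (0 : ℝ) ≤ R := Nat.cast_nonneg R
    rw [one_smul, zero_add, pow_one, pow_one]
    nlinarith
  | succ k ih =>
    obtain ⟨B, hB⟩ := ih
    refine ⟨(10 * B + 10) * (k + 2) + (15 * B + 14), fun R N M hR hMN f θ hf hS => ?_⟩
    have hR' : (2 : ℝ) ≤ R := by exact_mod_cast hR
    have hR1 : (1 : ℝ) ≤ R := by linarith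
    -- For short ranges `q = 1` suffices; this accounts for the summand `(10 * B + 10) * (k + 2)`.
    rcases le_or_gt N (R ^ (10 * B + 10)) with hN | hN
    · refine ⟨1, le_rfl, Nat.one_le_pow _ _ (by omega), ?_⟩
      have h1 : (N : ℝ) ≤ R ^ (10 * B + 10) := by exact_mod_cast hN
      have h2 : ‖1 • θ‖ ≤ 1 := by
        rw [one_smul]
        linarith [norm_circle_le_half θ]
      calc (N : ℝ) ^ (k + 1 + 1) * ‖1 • θ‖
          ≤ ((R : ℝ) ^ (10 * B + 10)) ^ (k + 1 + 1) * 1 := by gcongr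
        _ = (R : ℝ) ^ ((10 * B + 10) * (k + 2)) := by rw [mul_one, ← pow_mul]
        _ ≤ _ := pow_le_pow_right₀ hR1 (by omega)
    have hN10 : R ^ 10 < N := (Nat.pow_le_pow_right (by omega) (by omega)).trans_lt hN
    have hNpos : (0 : ℝ) < N := by
      have : 0 < N := by omega
      exact_mod_cast this
    have hG := card_large_differences hR hMN hN10 f hS
    set G := (range M).filter fun h => (N : ℝ) ≤ R ^ 5 *
      ‖∑ n ∈ range (M - (h + 1)), (AddCircle.toCircle (f (n + (h + 1)) - f n) : ℂ)‖ with hGdef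
    have hq : ∀ h : ℕ, ∃ q : ℕ, h ∈ G → 1 ≤ q ∧ q ≤ (R ^ 5) ^ B ∧
        (N : ℝ) ^ (k + 1) * ‖q • (h + 1) • θ‖ ≤ ((R : ℝ) ^ 5) ^ B := by
      intro h
      by_cases hh : h ∈ G
      · have hdiff : ∀ n, (fwdDiff 1)^[k + 1] (fun n => f (n + (h + 1)) - f n) n =
            (h + 1) • θ := fun n => by
          rw [fwdDiff_iterate_shift_sub]
          refine shift_sub_eq_nsmul (fun n => ?_) n (h + 1)
          rw [← hf n, Function.iterate_succ_apply' _ (k + 1)]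
        obtain ⟨q, h1, h2, h3⟩ := hB (R ^ 5) N (M - (h + 1))
          (hR.trans (Nat.le_self_pow (by norm_num) R)) ((Nat.sub_le _ _).trans hMN) _ _ hdiff
          (by push_cast; exact (mem_filter.1 hh).2)
        exact ⟨q, fun _ => ⟨h1, h2, by exact_mod_cast h3⟩⟩
      · exact ⟨0, fun h => absurd h hh⟩
    choose q hq using hq
    -- Fixing the most popular denominator `p` makes `p • θ` have densely many small multiples,
    -- which gains the missing factor `N`.
    obtain ⟨p, hp, hpcard⟩ := exists_card_le_mul_card_fiber (s := G)
      (t := Icc 1 ((R ^ 5) ^ B)) (f := q)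
      (fun h hh => mem_Icc.2 ⟨(hq h hh).1, (hq h hh).2.1⟩)
      ⟨1, mem_Icc.2 ⟨le_rfl, Nat.one_le_pow _ _ (Nat.pow_pos (by omega))⟩⟩
    rw [Nat.card_Icc, Nat.add_sub_cancel, ← pow_mul] at hpcard
    rw [mem_Icc, ← pow_mul] at hp
    set S := (G.filter fun h => q h = p).image fun h => h + 1 with hSdef
    have hScard : S.card = (G.filter fun h => q h = p).card :=
      card_image_of_injective _ (add_left_injective 1)
    have hpowle : ∀ {c a b : ℕ}, c ≤ 2 ^ a → (c : ℝ) * (R : ℝ) ^ b ≤ R ^ (a + b) := by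
      intro c a b hc
      rw [pow_add]
      refine mul_le_mul_of_nonneg_right ?_ (by positivity)
      exact_mod_cast hc.trans (Nat.pow_le_pow_left hR a)
    have hN' : (R : ℝ) ^ (10 * B + 10) < N := by exact_mod_cast hN
    have hNk : (N : ℝ) ≤ N ^ (k + 1) := by
      refine le_self_pow₀ ?_ (by omega)
      exact (one_le_pow₀ hR1).trans hN'.le
    obtain ⟨s, hs1, hs2, hs3⟩ := exists_nsmul_norm_le_of_dense (φ := p • θ) (N := N)
      (L := R ^ (5 * B + 5)) (ε := (R : ℝ) ^ (5 * B) / N ^ (k + 1)) (S := S)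
      (Nat.one_le_pow _ _ (by omega)) (by
        push_cast
        rw [← mul_div_assoc, div_le_one (by positivity), mul_assoc, ← pow_add]
        refine le_trans ?_ (hN'.le.trans hNk)
        have := hpowle (c := 32) (a := 5) (b := 5 * B + 5 + 5 * B) (by norm_num)
        rwa [show 5 + (5 * B + 5 + 5 * B) = 10 * B + 10 by omega] at this)
      (by
        intro h hh
        obtain ⟨x, hx, rfl⟩ := mem_image.1 hh
        have hxG := mem_filter.1 (mem_filter.1 hx).1
        have hxM := mem_range.1 hxG.1
        -- Equality would make the differenced sum empty, hence not large.
        have hne : x + 1 ≠ M := by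
          intro h
          have := hxG.2
          rw [h] at this
          simp only [Nat.sub_self, range_zero, sum_empty, norm_zero, mul_zero] at this
          linarith
        omega)
      (by
        rw [hScard, pow_add, mul_comm (R ^ (5 * B)), mul_assoc]
        exact hG.trans (Nat.mul_le_mul_left _ hpcard))
      (by
        refine lt_of_le_of_lt ?_ hN
        calc 2 * R ^ (5 * B + 5) ≤ R * R ^ (5 * B + 5) := Nat.mul_le_mul_right _ hR
          _ = R ^ (5 * B + 6) := by ring
          _ ≤ _ := Nat.pow_le_pow_right (by omega) (by omega))
      (by
        intro h hh
        obtain ⟨x, hx, rfl⟩ := mem_image.1 hh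
        obtain ⟨hxG, hxp⟩ := mem_filter.1 hx
        have := (hq x hxG).2.2
        rw [hxp, ← pow_mul, smul_comm] at this
        rw [le_div_iff₀ (by positivity), mul_comm]
        exact this)
    refine ⟨s * p, Nat.mul_pos hs1 hp.1, ?_, ?_⟩
    · calc s * p ≤ 2 * R ^ (5 * B + 5) * R ^ (5 * B) := Nat.mul_le_mul hs2 hp.2
        _ ≤ R * R ^ (5 * B + 5) * R ^ (5 * B) := by gcongr
        _ = R ^ (10 * B + 6) := by ring
        _ ≤ _ := Nat.pow_le_pow_right (by omega) (by omega)
    · rw [mul_nsmul' θ s p]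
      push_cast at hs3
      calc (N : ℝ) ^ (k + 1 + 1) * ‖s • p • θ‖ = N ^ (k + 1) * (N * ‖s • p • θ‖) := by ring
        _ ≤ N ^ (k + 1) * (16 * ((R : ℝ) ^ (5 * B + 5)) ^ 2 * (R ^ (5 * B) / N ^ (k + 1))) := by
            gcongr
        _ = (16 : ℕ) * (R : ℝ) ^ (15 * B + 10) := by
            field_simp
            push_cast
            ring
        _ ≤ (R : ℝ) ^ (4 + (15 * B + 10)) := hpowle (by norm_num)
        _ ≤ _ := pow_le_pow_right₀ hR1 (by
            have := Nat.zero_le ((10 * B + 10) * (k + 2))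
            omega)

/-! ### Recurrence of powers -/

theorem fwdDiff_iterate_pow_nsmul (k : ℕ) (β : UnitAddCircle) (n : ℕ) :
    (fwdDiff 1)^[k] (fun n : ℕ => (n + 1) ^ k • β) n = k.factorial • β := by
  have hhom : ∀ (j : ℕ) (g : ℤ → ℤ) (n : ℕ), (fwdDiff 1)^[j] (fun n : ℕ => g (n + 1) • β) n =
      ((fwdDiff 1)^[j] g (n + 1)) • β := by
    intro j
    induction j with
    | zero => intros; rfl
    | succ j ih =>
      intro g n
      rw [Function.iterate_succ_apply', Function.iterate_succ_apply', fwdDiff, fwdDiff, ih, ih,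
        sub_smul]
      push_cast
      rfl
  have h := hhom k (fun x => x ^ k) n
  rw [fwdDiff_iter_eq_factorial] at h
  rw [← natCast_zsmul, ← show ((fun _ => (k.factorial : ℤ)) ((n : ℤ) + 1)) = k.factorial from rfl]
  refine Eq.trans ?_ h
  congr 2

/-- If no `‖x n‖` is small, then some low frequency exponential sum along `x` is large. -/
theorem exists_large_sum_of_norm_large {R N : ℕ} (hR : 2 ≤ R) (x : ℕ → UnitAddCircle)
    (hx : ∀ n < N, 1 < R * ‖x n‖) :
    ∃ h : ℕ, 1 ≤ h ∧ h ≤ R ^ 2 ∧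
      (N : ℝ) ≤ R ^ 4 * ‖∑ n ∈ range N, (AddCircle.toCircle (h • x n) : ℂ)‖ := by
  by_contra! hcon
  have hR' : (2 : ℝ) ≤ R := by exact_mod_cast hR
  -- The diagonal contributes `R ^ 2 * N`, the off-diagonal terms at most `2 * N` in size, yet the
  -- geometric sums cap the total at `R ^ 2 * N / 4`.
  set H := R ^ 2 with hH
  have hupper : ∀ n < N, ‖∑ j ∈ range H, (AddCircle.toCircle (j • x n) : ℂ)‖ ^ 2 ≤
      (R : ℝ) ^ 2 / 4 := by
    intro n hn
    have h1 := norm_geom_sum_mul_le (x n) H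
    have h2 := hx n hn
    have h3 := norm_nonneg (∑ j ∈ range H, (AddCircle.toCircle (j • x n) : ℂ))
    have h4 : ‖∑ j ∈ range H, (AddCircle.toCircle (j • x n) : ℂ)‖ ≤ R / 2 := by
      nlinarith [mul_le_mul_of_nonneg_left h2.le h3]
    calc _ ≤ ((R : ℝ) / 2) ^ 2 := pow_le_pow_left₀ h3 h4 2
      _ = _ := by ring
  have hexp : ∀ n, ‖∑ j ∈ range H, (AddCircle.toCircle (j • x n) : ℂ)‖ ^ 2 = H + 2 *
      (∑ h ∈ range H, ∑ j ∈ range (H - (h + 1)),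
        (AddCircle.toCircle ((h + 1) • x n) : ℂ)).re := by
    intro n
    rw [norm_sq_sum_range (fun j => (AddCircle.toCircle (j • x n) : ℂ)) fun j => Circle.norm_coe _]
    congr 3
    refine sum_congr rfl fun h _ => sum_congr rfl fun j _ => ?_
    rw [toCircle_mul_conj, add_nsmul, add_sub_cancel_left]
  rcases Nat.eq_zero_or_pos N with rfl | hNpos
  · have := hcon 1 le_rfl (Nat.one_le_pow _ _ (by omega))
    simp at this
  have hN0 : (0 : ℝ) < N := by exact_mod_cast hNpos
  have htotal : ∑ n ∈ range N, ‖∑ j ∈ range H, (AddCircle.toCircle (j • x n) : ℂ)‖ ^ 2 ≤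
      N * ((R : ℝ) ^ 2 / 4) := by
    have := sum_le_card_nsmul (range N) _ _ fun n hn => hupper n (mem_range.1 hn)
    simpa using this
  simp only [hexp] at htotal
  rw [sum_add_distrib, ← mul_sum, ← Complex.re_sum, sum_const, card_range, nsmul_eq_mul] at htotal
  have hoff : ‖∑ n ∈ range N, ∑ h ∈ range H, ∑ j ∈ range (H - (h + 1)),
      (AddCircle.toCircle ((h + 1) • x n) : ℂ)‖ ≤ H * (H * (N / R ^ 4)) := by
    rw [sum_comm]
    refine (norm_sum_le_of_le (range H) (fun h hh => ?_)).trans_eq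
      ((sum_const (H * ((N : ℝ) / R ^ 4))).trans (by rw [card_range, nsmul_eq_mul]))
    have hlt := mem_range.1 hh
    simp only [sum_const, card_range, nsmul_eq_mul]
    rw [← mul_sum, norm_mul, Complex.norm_natCast]
    have hc := hcon (h + 1) (by omega) (by omega)
    refine mul_le_mul (by exact_mod_cast Nat.sub_le _ _) ?_ (norm_nonneg _) (Nat.cast_nonneg _)
    rw [le_div_iff₀ (by positivity), mul_comm]
    exact hc.le
  have h1 := (abs_le.1 ((Complex.abs_re_le_norm _).trans hoff)).1
  have hHR : (H : ℝ) = R ^ 2 := by rw [hH]; push_cast; rfl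
  rw [hHR] at h1 htotal
  have h2 : (R : ℝ) ^ 2 * (R ^ 2 * (N / R ^ 4)) = N := by field_simp
  rw [h2] at h1
  have h4 : (N : ℝ) * 4 ≤ N * R ^ 2 := mul_le_mul_of_nonneg_left (by nlinarith) hN0.le
  linarith

/-- Recurrence of `k`-th powers for a single frequency. -/
theorem exists_pow_nsmul_norm_le (k : ℕ) : ∃ B : ℕ, ∀ R : ℕ, 2 ≤ R → ∀ α : UnitAddCircle,
    ∃ q : ℕ, 1 ≤ q ∧ q ≤ R ^ B ∧ R * ‖q ^ (k + 1) • α‖ ≤ 1 := by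
  obtain ⟨B, hB⟩ := exists_nsmul_norm_le_of_large_sum k
  set F := (k + 1).factorial with hF
  -- The summands pay for `s`, `h` and the factorial; the final `1` absorbs the factor `R`.
  set E := 4 * B + 2 + F + 1 with hE
  refine ⟨E, fun R hR α => ?_⟩
  by_contra! hcon
  have hR' : (2 : ℝ) ≤ R := by exact_mod_cast hR
  obtain ⟨h, h1, h2, hS⟩ := exists_large_sum_of_norm_large (N := R ^ E) hR
    (fun n => (n + 1) ^ (k + 1) • α) (fun n hn => hcon (n + 1) (by omega) hn)
  have hdiff : ∀ n, (fwdDiff 1)^[k + 1] (fun n : ℕ => h • (n + 1) ^ (k + 1) • α) n =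
      F • h • α := fun n => by
    simp only [smul_comm h]
    exact fwdDiff_iterate_pow_nsmul (k + 1) (h • α) n
  obtain ⟨s, hs1, hs2, hs3⟩ := hB (R ^ 4) (R ^ E) (R ^ E)
    (hR.trans (Nat.le_self_pow (by norm_num) R)) le_rfl _ _ hdiff (by
      push_cast at hS ⊢
      exact hS)
  rw [smul_smul, smul_smul, mul_assoc] at hs3
  push_cast at hs3
  rw [← pow_mul (R : ℝ) 4 B] at hs3
  rw [← pow_mul] at hs2
  set Q := s * (F * h) with hQ
  have hQ1 : 1 ≤ Q := Nat.mul_pos hs1 (Nat.mul_pos (Nat.factorial_pos _) h1)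
  have hFR : F ≤ R ^ F := (Nat.lt_pow_self (by omega)).le
  have hQ2 : Q ≤ R ^ (4 * B + 2 + F) := by
    calc Q ≤ R ^ (4 * B) * (R ^ F * R ^ 2) :=
          Nat.mul_le_mul hs2 (Nat.mul_le_mul hFR h2)
      _ = _ := by ring
  have hQE : Q ≤ R ^ E := hQ2.trans (Nat.pow_le_pow_right (by omega) (by omega))
  refine absurd (hcon Q hQ1 hQE) (not_lt.2 ?_)
  have hQE' : (Q : ℝ) ≤ R ^ (4 * B + 2 + F) := by exact_mod_cast hQ2
  have hnorm : ‖Q ^ (k + 1) • α‖ ≤ Q ^ k * ‖Q • α‖ := by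
    rw [pow_succ, mul_nsmul']
    exact_mod_cast norm_nsmul_le (n := Q ^ k) (a := Q • α)
  have hpos : (0 : ℝ) < (R ^ E) ^ (k + 1) := by positivity
  have hα : ‖Q • α‖ ≤ (R : ℝ) ^ (4 * B) / (R ^ E) ^ (k + 1) := by
    rw [le_div_iff₀ hpos, mul_comm]
    exact hs3
  calc (R : ℝ) * ‖Q ^ (k + 1) • α‖
      ≤ R * ((R ^ (4 * B + 2 + F)) ^ k * (R ^ (4 * B) / (R ^ E) ^ (k + 1))) := by
        refine mul_le_mul_of_nonneg_left (hnorm.trans ?_) (by positivity)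
        gcongr
    _ ≤ R * ((R ^ E) ^ k * (R ^ (E - 1) / (R ^ E) ^ (k + 1))) := by
        gcongr <;> first | linarith | omega
    _ = 1 := by
        rw [show (R : ℝ) ^ E = R ^ (E - 1) * R from by rw [← pow_succ]; rfl]
        field_simp
        ring

/-- Simultaneous recurrence of `k`-th powers. -/
theorem exists_pow_nsmul_norm_le_simultaneous (k : ℕ) (hk : 1 ≤ k) :
    ∃ D : ℕ, 2 ≤ D ∧ ∀ (r R : ℕ), 2 ≤ R → ∀ α : Fin r → UnitAddCircle,
      ∃ q : ℕ, 1 ≤ q ∧ q ≤ R ^ D ^ r ∧ ∀ i, R * ‖q ^ k • α i‖ ≤ 1 := by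
  obtain ⟨k, rfl⟩ := Nat.exists_eq_add_of_le' hk
  obtain ⟨B, hB⟩ := exists_pow_nsmul_norm_le k
  set D := (k + 1) * B + B + 2 with hD
  have key : ∀ (r R : ℕ), 2 ≤ R → ∀ α : Fin r → UnitAddCircle,
      ∃ q : ℕ, 1 ≤ q ∧ q ≤ R ^ (D ^ r - 1) ∧ ∀ i, R * ‖q ^ (k + 1) • α i‖ ≤ 1 := by
    intro r
    induction r with
    | zero => exact fun R hR α => ⟨1, le_rfl, Nat.one_le_pow _ _ (by omega), fun i => i.elim0⟩
    | succ r ih =>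
      intro R hR α
      -- The extra accuracy pays for multiplying later by `s ^ (k + 1) ≤ R ^ ((k + 1) * B)`.
      obtain ⟨p, hp1, hp2, hp3⟩ := ih (R ^ ((k + 1) * B + 1))
        (hR.trans (Nat.le_self_pow (by omega) R)) fun i => α i.castSucc
      obtain ⟨s, hs1, hs2, hs3⟩ := hB R hR (p ^ (k + 1) • α (Fin.last r))
      refine ⟨s * p, Nat.mul_pos hs1 hp1, ?_, fun i => ?_⟩
      · refine (Nat.mul_le_mul hs2 hp2).trans ?_
        rw [← pow_mul, ← pow_add]
        refine Nat.pow_le_pow_right (by omega) ?_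
        have h1 : 1 ≤ D ^ r := Nat.one_le_pow _ _ (by omega)
        obtain ⟨t, ht⟩ := Nat.exists_eq_add_of_le' h1
        rw [pow_succ, ht, Nat.add_sub_cancel, hD]
        refine Nat.le_sub_of_add_le ?_
        nlinarith
      · rw [mul_pow, mul_nsmul']
        induction i using Fin.lastCases with
        | last => exact hs3
        | cast i =>
          have h1 : ‖s ^ (k + 1) • p ^ (k + 1) • α i.castSucc‖ ≤
              (s : ℝ) ^ (k + 1) * ‖p ^ (k + 1) • α i.castSucc‖ := by
            exact_mod_cast norm_nsmul_le (n := s ^ (k + 1)) (a := p ^ (k + 1) • α i.castSucc)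
          have h2 : (s : ℝ) ≤ R ^ B := by exact_mod_cast hs2
          have h3 := hp3 i
          push_cast at h3
          calc (R : ℝ) * ‖s ^ (k + 1) • p ^ (k + 1) • α i.castSucc‖
              ≤ R * ((R ^ B) ^ (k + 1) * ‖p ^ (k + 1) • α i.castSucc‖) := by
                refine mul_le_mul_of_nonneg_left (h1.trans ?_) (by positivity)
                gcongr
            _ = R ^ ((k + 1) * B + 1) * ‖p ^ (k + 1) • α i.castSucc‖ := by ring
            _ ≤ 1 := h3
  refine ⟨D, by omega, fun r R hR α => ?_⟩
  obtain ⟨q, h1, h2, h3⟩ := key r R hR α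
  exact ⟨q, h1, h2.trans (Nat.pow_le_pow_right (by omega) (Nat.sub_le _ _)), h3⟩

theorem lemma6p3 (k : ℕ) (hk : 1 ≤ k) :
    ∃ C A : ℝ, 0 < C ∧ 0 < A ∧
      ∀ (r : ℕ) (α : Fin r → UnitAddCircle) (Q : ℝ), 1 ≤ Q →
        ∃ q : ℕ, 1 ≤ q ∧ (q : ℝ) ≤ Q ∧
          ∀ i : Fin r, ‖q ^ k • α i‖ ≤ A * Q ^ (-Real.exp (-(C * (r : ℝ)))) := by
  obtain ⟨D, hD, hrec⟩ := exists_pow_nsmul_norm_le_simultaneous k hk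
  have hD' : (1 : ℝ) < D := by exact_mod_cast hD
  refine ⟨Real.log D, 2, Real.log_pos hD', two_pos, fun r α Q hQ => ?_⟩
  have hQ0 : 0 < Q := by linarith
  have hexp : Real.exp (-(Real.log D * r)) = ((D : ℝ) ^ r)⁻¹ := by
    rw [Real.exp_neg, mul_comm, Real.exp_nat_mul, Real.exp_log (by linarith)]
  rw [hexp, Real.rpow_neg hQ0.le]
  set y := Q ^ ((D : ℝ) ^ r)⁻¹ with hy
  have hy1 : 1 ≤ y := Real.one_le_rpow hQ (by positivity)
  have hyQ : y ^ D ^ r = Q := by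
    rw [hy]
    exact_mod_cast Real.rpow_inv_natCast_pow hQ0.le (n := D ^ r) (by positivity)
  have hfloor := Nat.floor_le (show 0 ≤ y by linarith)
  have hlt := Nat.lt_floor_add_one y
  -- With `A = 2` the bound is trivial when `y < 2`; otherwise `y ≤ 2 * ⌊y⌋₊` covers the rounding.
  rcases lt_or_ge ⌊y⌋₊ 2 with hR | hR
  · refine ⟨1, le_rfl, by simpa using hQ, fun i => ?_⟩
    have h1 : (⌊y⌋₊ : ℝ) ≤ 1 := by exact_mod_cast Nat.lt_succ_iff.1 hR
    refine (norm_circle_le_half _).trans ?_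
    rw [← div_eq_mul_inv, div_le_div_iff₀ two_pos (by linarith)]
    linarith
  · obtain ⟨q, hq1, hq2, hq3⟩ := hrec r ⌊y⌋₊ hR α
    refine ⟨q, hq1, ?_, fun i => ?_⟩
    · calc (q : ℝ) ≤ (⌊y⌋₊ : ℝ) ^ D ^ r := by exact_mod_cast hq2
        _ ≤ y ^ D ^ r := pow_le_pow_left₀ (Nat.cast_nonneg _) hfloor _
        _ = Q := hyQ
    · rw [← div_eq_mul_inv, le_div_iff₀ (by linarith)]
      have h2 : (2 : ℝ) ≤ ⌊y⌋₊ := by exact_mod_cast hR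
      nlinarith [hq3 i, norm_nonneg (q ^ k • α i)]
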